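/- Let $f(z)=\sum_{n=0}^{\infty}a_nz^n$ be an analytic map of the open unit disk $\{|z|<1\}$ into itself, and for $0\le r<1$ let $S_r=S_r(f)<\infty$ denote the area, counted with multiplicity, of the image of $\{|z|<r\}$ under $f$, that is, $S_r=\int_{\mathbb C}\#\{z:|z|<r,\ f(z)=w\}\,dA(w)$ (the area of the Riemann surface of $f^{-1}$ over this image). For $c>0$ put $$D_c(f,r)=\sum_{n=0}^{\infty}|a_n|r^n+\left(\frac1{1+|a_0|}+\frac r{1-r}\right)\sum_{n=1}^{\infty}|a_n|^2r^{2n}+c\,\frac{S_r}{\pi},$$ $$E_c(f,r)=|a_0|^2+\sum_{n=1}^{\infty}|a_n|r^n+\left(\frac1{1+|a_0|}+\frac r{1-r}\right)\sum_{n=1}^{\infty}|a_n|^2r^{2n}+c\,\frac{S_r}{\pi}.$$ All these series converge for $0\le r<1$, and the following hold. (1) $D_{8/9}(f,r)\le 1$ for every such $f$ and all $0\le r\le \frac13$. The numbers $\frac13$ and $\frac89$ cannot be improved: for every $r\in(\frac13,1)$ there is an analytic self-map $f$ of the unit disk with $D_{8/9}(f,r)>1$, and for every $c>\frac89$ there is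 one with $D_c(f,\frac13)>1$. (2) $E_{9/8}(f,r)\le 1$ for every such $f$ and all $0\le r\le \frac1{3-|a_0|}$. The constant $\frac98$ cannot be improved: for every $c>\frac98$ there is an analytic self-map $f$ of the unit disk with $E_c\bigl(f,\frac1{3-|a_0|}\bigr)>1$, where $a_0=f(0)$. -/

import Mathlib

open scoped ENNReal

/-- The class of analytic self-maps of the open unit disk. Only the values on the disk matter. -/
structure IsAnalyticSelfMap (f : ℂ → ℂ) : Prop where
  analytic : AnalyticOnNhd ℂ f (Metric.ball 0 1)
  mapsTo : Set.MapsTo f (Metric.ball 0 1) (Metric.ball 0 1)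

/-- The `n`-th Taylor coefficient of `f` at the origin, so that `f z = ∑ aₙ zⁿ` on the disk. -/
noncomputable def taylorCoeff (f : ℂ → ℂ) (n : ℕ) : ℂ :=
  iteratedDeriv n f 0 / (n.factorial : ℂ)

/-- The area, counted with multiplicity, of the image of `{|z| < r}` under `f`: the area of the
Riemann surface of `f⁻¹` spread over that image. Each point `w` of the plane is weighted by the
number of its preimages in `{|z| < r}`. (Counting a preimage with its order would change the
weight only at critical values, which form a null set.) -/
noncomputable def imageArea (f : ℂ → ℂ) (r : ℝ) : ℝ≥0∞ :=
  ∫⁻ w : ℂ, (({z : ℂ | z ∈ Metric.ball (0 : ℂ) r ∧ f z = w}.encard : ℕ∞) : ℝ≥0∞)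

/-- `(1 / (1 + |a₀|) + r / (1 - r)) ∑_{n ≥ 1} |aₙ|² r²ⁿ + c Sᵣ / π`. -/
noncomputable def refinementTerm (c : ℝ) (f : ℂ → ℂ) (r : ℝ) : ℝ :=
  (1 / (1 + ‖taylorCoeff f 0‖) + r / (1 - r)) *
      ∑' n : ℕ, ‖taylorCoeff f (n + 1)‖ ^ 2 * r ^ (2 * (n + 1))
    + c * ((imageArea f r).toReal / Real.pi)

/-- The refined Bohr sum starting with `|a₀|`, with constant `c` at the area term. -/
noncomputable def bohrSumD (c : ℝ) (f : ℂ → ℂ) (r : ℝ) : ℝ :=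
  (∑' n : ℕ, ‖taylorCoeff f n‖ * r ^ n) + refinementTerm c f r

/-- The refined Bohr sum starting with `|a₀|²`, with constant `c` at the area term. -/
noncomputable def bohrSumE (c : ℝ) (f : ℂ → ℂ) (r : ℝ) : ℝ :=
  ‖taylorCoeff f 0‖ ^ 2 + (∑' n : ℕ, ‖taylorCoeff f (n + 1)‖ * r ^ (n + 1))
    + refinementTerm c f r

/-!
Multiplication by a self-map `f = ∑ cₙ zⁿ` of the disk is a contraction of the Hardy space, hence of
`ℓ²` truncated at any order. Testing this contraction on suitable polynomials gives the coefficient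
inequalities `|c_{2n+1}| + ∑_{k ≤ n} |cₖ|² ≤ 1`, its companion for even orders, and
`∑_{1 ≤ k ≤ n} |cₖ|² ≤ (1 - |c₀|²)² ∑_{k < n} |c₀|^{2k}`. Summed against the geometric weights `rⁿ`,
the first two bound the coefficient part of the Bohr sums by `(1 - |c₀|²) r / (1 - r)`. The area of
the image is `∫ |f'|² = π ∑ n |cₙ|² r²ⁿ`; the weights `n qⁿ` decrease when `q = r² ≤ 1 / 2`, so
summation by parts against the third inequality bounds it. All the resulting bounds are attained by
the disk automorphism exchanging `0` and `a = |c₀|`, so both claims, and their sharpness as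
`a → 1`, reduce to rational functions of `a`.
-/

open MeasureTheory Filter Topology ComplexConjugate
open PowerSeries (coeff trunc)
open Real (circleAverage)

theorem sum_sq_norm_coeff_mul_pow_eq_circleAverage {p : Polynomial ℂ} {N : ℕ} (hp : p.degree < N)
    (r : ℝ) : ∑ n ∈ Finset.range N, ‖p.coeff n‖ ^ 2 * r ^ (2 * n) =
      circleAverage (fun z => ‖p.eval z‖ ^ 2) 0 r := by
  set q := p.comp (Polynomial.C (r : ℂ) * Polynomial.X)
  have hq (n : ℕ) : ‖q.coeff n‖ ^ 2 = ‖p.coeff n‖ ^ 2 * r ^ (2 * n) := by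
    rw [Polynomial.comp_C_mul_X_coeff, norm_mul, norm_pow, Complex.norm_real, Real.norm_eq_abs,
      mul_pow, pow_right_comm, sq_abs, ← pow_mul]
  have hsupp : q.support ⊆ Finset.range N := fun n hn => by
    contrapose! hn
    simp [q, Polynomial.comp_C_mul_X_coeff,
      Polynomial.coeff_eq_zero_of_degree_lt (hp.trans_le (by simpa using hn))]
  rw [Real.circleAverage_eq_circleAverage_zero_one]
  simp_rw [← hq]
  rw [← Finset.sum_subset hsupp fun n _ hn => by simp [Polynomial.notMem_support_iff.1 hn],
    q.sum_sq_norm_coeff_eq_circleAverage]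
  simp [q]

/-- The power series `φ` converges to `h` on the open unit disk. The formal series is kept apart
from its sum so that coefficient identities can be proved in the ring `ℂ⟦X⟧`. -/
def HasDiskSeries (φ : PowerSeries ℂ) (h : ℂ → ℂ) : Prop :=
  ∀ z : ℂ, ‖z‖ < 1 → HasSum (fun n => coeff n φ * z ^ n) (h z)

namespace HasDiskSeries

variable {φ ψ : PowerSeries ℂ} {h k : ℂ → ℂ} {r : ℝ}

theorem summable_norm (hφ : HasDiskSeries φ h) (hr : 0 ≤ r) (hr1 : r < 1) :
    Summable fun n => ‖coeff n φ‖ * r ^ n := by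
  simpa [abs_of_nonneg hr] using (hφ r (by simpa [abs_of_nonneg hr] using hr1)).summable.norm

theorem mul (hφ : HasDiskSeries φ h) (hψ : HasDiskSeries ψ k) :
    HasDiskSeries (φ * ψ) fun z => h z * k z := by
  intro z hz
  have hprod := (summable_norm_sum_mul_antidiagonal_of_summable_norm (hφ z hz).summable.norm
    (hψ z hz).summable.norm).of_norm.hasSum
  rw [← tsum_mul_tsum_eq_tsum_sum_antidiagonal_of_summable_norm (hφ z hz).summable.norm
    (hψ z hz).summable.norm, (hφ z hz).tsum_eq, (hψ z hz).tsum_eq] at hprod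
  refine hprod.congr_fun fun n => ?_
  rw [PowerSeries.coeff_mul, Finset.sum_mul]
  refine Finset.sum_congr rfl fun ij hij => ?_
  rw [← Finset.HasAntidiagonal.mem_antidiagonal.1 hij, pow_add, mul_mul_mul_comm]

theorem sub (hφ : HasDiskSeries φ h) (hψ : HasDiskSeries ψ k) :
    HasDiskSeries (φ - ψ) fun z => h z - k z := fun z hz => by
  simpa [sub_mul] using (hφ z hz).sub (hψ z hz)

theorem of_polynomial (p : Polynomial ℂ) : HasDiskSeries p fun z => p.eval z := fun z _ => by
  simpa [Polynomial.eval_eq_sum, Polynomial.sum] using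
    hasSum_sum_of_ne_finset_zero (f := fun n => p.coeff n * z ^ n) (s := p.support)
      (L := .unconditional ℕ) fun n hn => by simp [Polynomial.notMem_support_iff.1 hn]

theorem continuousOn (hφ : HasDiskSeries φ h) (hr : 0 ≤ r) (hr1 : r < 1) :
    ContinuousOn h (Metric.closedBall 0 r) := by
  have hnorm : ∀ z ∈ Metric.closedBall (0 : ℂ) r, ‖z‖ ≤ r := fun z hz => by simpa using hz
  refine (continuousOn_tsum (fun n => by fun_prop) (hφ.summable_norm hr hr1)
    fun n z hz => ?_).congr fun z hz => ((hφ z ((hnorm z hz).trans_lt hr1)).tsum_eq).symm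
  rw [norm_mul, norm_pow]
  gcongr
  exact hnorm z hz

theorem hasSum_sq_norm_coeff (hφ : HasDiskSeries φ h) (hr : 0 ≤ r) (hr1 : r < 1) :
    HasSum (fun n => ‖coeff n φ‖ ^ 2 * r ^ (2 * n)) (circleAverage (fun z => ‖h z‖ ^ 2) 0 r) := by
  have hpartial (N : ℕ) : ∑ n ∈ Finset.range N, ‖coeff n φ‖ ^ 2 * r ^ (2 * n) =
      circleAverage (fun z => ‖(trunc N φ).eval z‖ ^ 2) 0 r := by
    rw [← sum_sq_norm_coeff_mul_pow_eq_circleAverage (PowerSeries.degree_trunc_lt φ N)]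
    exact Finset.sum_congr rfl fun n hn => by
      rw [PowerSeries.coeff_trunc, if_pos (Finset.mem_range.1 hn)]
  have heval (N : ℕ) (z : ℂ) :
      (trunc N φ).eval z = ∑ n ∈ Finset.range N, coeff n φ * z ^ n :=
    PowerSeries.eval₂_trunc_eq_sum_range z (RingHom.id ℂ) N φ
  have hnorm (θ : ℝ) : ‖circleMap 0 r θ‖ = r := by simp [abs_of_nonneg hr]
  rw [hasSum_iff_tendsto_nat_of_nonneg fun n => by positivity]
  simp_rw [hpartial]
  refine (intervalIntegral.tendsto_integral_filter_of_dominated_convergence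
    (fun _ => (∑' n, ‖coeff n φ‖ * r ^ n) ^ 2)
    (.of_forall fun N => (Continuous.aestronglyMeasurable (by fun_prop)))
    (.of_forall fun N => .of_forall fun θ _ => ?_) (by simp)
    (.of_forall fun θ _ => ?_)).const_smul _
  · rw [norm_pow, norm_norm, heval]
    gcongr
    refine (norm_sum_le _ _).trans ((Finset.sum_le_sum fun n _ => ?_).trans
      ((hφ.summable_norm hr hr1).sum_le_tsum (Finset.range N) fun n _ => by positivity))
    rw [norm_mul, norm_pow, hnorm]
  · simp_rw [heval]
    exact ((hφ _ (by rwa [hnorm])).tendsto_sum_nat.norm).pow 2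

theorem unique (hφ : HasDiskSeries φ h) (hψ : HasDiskSeries ψ h) : φ = ψ := by
  have hzero := (hφ.sub hψ).hasSum_sq_norm_coeff (r := 1 / 2) (by norm_num) (by norm_num)
  simp only [sub_self, norm_zero, ne_eq, OfNat.ofNat_ne_zero, not_false_eq_true, zero_pow,
    Real.circleAverage_const] at hzero
  ext n
  simpa [sub_eq_zero] using
    congrFun ((hasSum_zero_iff_of_nonneg fun n => by positivity).1 hzero) n

theorem apply_zero (hφ : HasDiskSeries φ h) : h 0 = coeff 0 φ := by
  simpa using (hφ 0 (by simp)).unique (hasSum_single 0 fun n hn => by simp [hn])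

theorem circleAverage_sq_norm_mul_le (hφ : HasDiskSeries φ h) (hψ : HasDiskSeries ψ k)
    (hk : ∀ z : ℂ, ‖z‖ < 1 → ‖k z‖ ≤ 1) (hr : 0 ≤ r) (hr1 : r < 1) :
    circleAverage (fun z => ‖h z * k z‖ ^ 2) 0 r ≤
      circleAverage (fun z => ‖h z‖ ^ 2) 0 r := by
  have hh := (hφ.continuousOn hr hr1).mono Metric.sphere_subset_closedBall
  have hhk := ((hφ.mul hψ).continuousOn hr hr1).mono Metric.sphere_subset_closedBall
  refine Real.circleAverage_mono ((hhk.norm.pow 2).circleIntegrable hr)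
    ((hh.norm.pow 2).circleIntegrable hr) fun z hz => ?_
  have hz1 : ‖z‖ < 1 := by
    rwa [mem_sphere_zero_iff_norm.1 hz, abs_of_nonneg hr]
  rw [norm_mul]
  gcongr
  exact mul_le_of_le_one_right (norm_nonneg _) (hk z hz1)

theorem sum_sq_norm_coeff_mul_le (hφ : HasDiskSeries φ h) (hh : ∀ z : ℂ, ‖z‖ < 1 → ‖h z‖ ≤ 1)
    (g : PowerSeries ℂ) (N : ℕ) :
    ∑ n ∈ Finset.range N, ‖coeff n (g * φ)‖ ^ 2 ≤ ∑ n ∈ Finset.range N, ‖coeff n g‖ ^ 2 := by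
  set p : Polynomial ℂ := trunc N g
  have hp : HasDiskSeries p fun z => p.eval z := of_polynomial p
  have hcoeff (n) (hn : n ∈ Finset.range N) : p.coeff n = coeff n g := by
    rw [PowerSeries.coeff_trunc, if_pos (Finset.mem_range.1 hn)]
  have hcoeff_mul (n) (hn : n ∈ Finset.range N) :
      coeff n ((p : PowerSeries ℂ) * φ) = coeff n (g * φ) := by
    rw [PowerSeries.coeff_mul, PowerSeries.coeff_mul]
    refine Finset.sum_congr rfl fun ij hij => ?_
    rw [PowerSeries.coeff_coe_trunc_of_lt
      ((Finset.HasAntidiagonal.antidiagonal.fst_le hij).trans_lt (Finset.mem_range.1 hn))]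
  have hle : ∀ᶠ r : ℝ in 𝓝[<] 1,
      ∑ n ∈ Finset.range N, ‖coeff n (g * φ)‖ ^ 2 * r ^ (2 * n) ≤
        ∑ n ∈ Finset.range N, ‖coeff n g‖ ^ 2 * r ^ (2 * n) := by
    filter_upwards [Ico_mem_nhdsLT zero_lt_one] with r ⟨hr, hr1⟩
    calc ∑ n ∈ Finset.range N, ‖coeff n (g * φ)‖ ^ 2 * r ^ (2 * n)
        = ∑ n ∈ Finset.range N, ‖coeff n ((p : PowerSeries ℂ) * φ)‖ ^ 2 * r ^ (2 * n) :=
          Finset.sum_congr rfl fun n hn => by rw [hcoeff_mul n hn]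
      _ ≤ circleAverage (fun z => ‖p.eval z * h z‖ ^ 2) 0 r :=
          sum_le_hasSum _ (fun n _ => by positivity) ((hp.mul hφ).hasSum_sq_norm_coeff hr hr1)
      _ ≤ circleAverage (fun z => ‖p.eval z‖ ^ 2) 0 r :=
          hp.circleAverage_sq_norm_mul_le hφ hh hr hr1
      _ = ∑ n ∈ Finset.range N, ‖coeff n g‖ ^ 2 * r ^ (2 * n) := by
          rw [← sum_sq_norm_coeff_mul_pow_eq_circleAverage (PowerSeries.degree_trunc_lt g N)]
          exact Finset.sum_congr rfl fun n hn => by rw [hcoeff n hn]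
  have hlim (u : ℕ → ℝ) : Tendsto (fun r : ℝ => ∑ n ∈ Finset.range N, u n * r ^ (2 * n)) (𝓝[<] 1)
      (𝓝 (∑ n ∈ Finset.range N, u n)) := by
    have hcont : Continuous fun r : ℝ => ∑ n ∈ Finset.range N, u n * r ^ (2 * n) := by fun_prop
    simpa using hcont.continuousWithinAt.tendsto (x := 1) (s := Set.Iio 1)
  exact le_of_tendsto_of_tendsto (hlim _) (hlim _) hle

end HasDiskSeries

section TestPolynomial

variable (μ : ℂ) (m : ℕ) (φ : PowerSeries ℂ)

theorem coeff_one_add_C_mul_X_pow_mul (k : ℕ) :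
    coeff k ((1 + PowerSeries.C μ * PowerSeries.X ^ m) * φ) =
      coeff k φ + if m ≤ k then μ * coeff (k - m) φ else 0 := by
  rw [add_mul, one_mul, mul_assoc, map_add, PowerSeries.coeff_C_mul, PowerSeries.coeff_X_pow_mul',
    mul_ite, mul_zero]

theorem sum_sq_norm_coeff_one_add_C_mul_X_pow_mul :
    ∑ k ∈ Finset.range (m + 1),
        ‖coeff k ((1 + PowerSeries.C μ * PowerSeries.X ^ m) * φ)‖ ^ 2 =
      ∑ k ∈ Finset.range m, ‖coeff k φ‖ ^ 2 + ‖coeff m φ + μ * coeff 0 φ‖ ^ 2 := by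
  rw [Finset.sum_range_succ, coeff_one_add_C_mul_X_pow_mul, if_pos le_rfl, Nat.sub_self]
  refine congrArg (· + _) (Finset.sum_congr rfl fun k hk => ?_)
  rw [coeff_one_add_C_mul_X_pow_mul, if_neg (Finset.mem_range.1 hk).not_ge, add_zero]

theorem sum_sq_norm_coeff_one_add_C_mul_X_pow_succ :
    ∑ k ∈ Finset.range (m + 2),
        ‖coeff k (1 + PowerSeries.C μ * PowerSeries.X ^ (m + 1))‖ ^ 2 = 1 + ‖μ‖ ^ 2 := by
  have hone := sum_sq_norm_coeff_one_add_C_mul_X_pow_mul μ (m + 1) 1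
  rw [mul_one] at hone
  rw [hone]
  simp [PowerSeries.coeff_one, apply_ite]

end TestPolynomial

namespace HasDiskSeries

variable {φ : PowerSeries ℂ} {h : ℂ → ℂ}

-- Test the contraction on `p + Xᴺ q`, where `q` is the reversed conjugate of `∑_{i ≤ l} cᵢ Xⁱ`,
-- rotated so that the coefficients of order `N + l` of `p φ` and `Xᴺ q φ` add up.
theorem sum_sq_norm_coeff_mul_add_sq_le (hφ : HasDiskSeries φ h)
    (hh : ∀ z : ℂ, ‖z‖ < 1 → ‖h z‖ ≤ 1) {p : PowerSeries ℂ} {N : ℕ}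
    (hp : ∀ j, N ≤ j → coeff j p = 0) (l : ℕ) :
    ∑ k ∈ Finset.range N, ‖coeff k (p * φ)‖ ^ 2 +
        (‖coeff (N + l) (p * φ)‖ + ∑ i ∈ Finset.range (l + 1), ‖coeff i φ‖ ^ 2) ^ 2 ≤
      ∑ j ∈ Finset.range N, ‖coeff j p‖ ^ 2 + ∑ i ∈ Finset.range (l + 1), ‖coeff i φ‖ ^ 2 := by
  set s := ∑ i ∈ Finset.range (l + 1), ‖coeff i φ‖ ^ 2
  obtain ⟨t, ht, hpφ⟩ : ∃ t : ℂ, ‖t‖ = 1 ∧ t * ‖coeff (N + l) (p * φ)‖ = coeff (N + l) (p * φ) :=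
    RCLike.exists_norm_mul_eq_self _
  set q : PowerSeries ℂ := PowerSeries.mk fun i => t * conj (coeff (l - i) φ)
  have hlow {ψ χ : PowerSeries ℂ} {k : ℕ} (hk : k ∈ Finset.range N) :
      coeff k (ψ + PowerSeries.X ^ N * χ) = coeff k ψ := by
    simp [PowerSeries.coeff_X_pow_mul', not_le.2 (Finset.mem_range.1 hk)]
  have hgφ : (p + PowerSeries.X ^ N * q) * φ = p * φ + PowerSeries.X ^ N * (q * φ) := by ring
  have hqφ : coeff l (q * φ) = t * s := by
    simp only [PowerSeries.coeff_mul, Finset.Nat.sum_antidiagonal_eq_sum_range_succ_mk,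
      ← Finset.sum_range_reflect (fun i => ‖coeff i φ‖ ^ 2) (l + 1), q, s,
      PowerSeries.coeff_mk, Complex.ofReal_sum, Finset.mul_sum]
    refine Finset.sum_congr rfl fun i _ => ?_
    rw [mul_assoc, Complex.conj_mul', Complex.ofReal_pow, Nat.add_sub_cancel]
  have htop : ‖coeff (N + l) ((p + PowerSeries.X ^ N * q) * φ)‖ =
      ‖coeff (N + l) (p * φ)‖ + s := by
    rw [hgφ, map_add, add_comm N l, PowerSeries.coeff_X_pow_mul, hqφ, add_comm l N]
    have hs : 0 ≤ s := Finset.sum_nonneg fun i _ => by positivity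
    conv_lhs => rw [← hpφ, ← mul_add, ← Complex.ofReal_add, norm_mul, ht, one_mul,
      Complex.norm_of_nonneg (by positivity)]
  have hhigh : ∑ i ∈ Finset.range (l + 1), ‖coeff (N + i) (p + PowerSeries.X ^ N * q)‖ ^ 2 = s := by
    rw [← Finset.sum_range_reflect]
    refine Finset.sum_congr rfl fun i hi => ?_
    rw [map_add, hp _ le_self_add, zero_add, add_comm N, PowerSeries.coeff_X_pow_mul,
      PowerSeries.coeff_mk, norm_mul, ht, one_mul, RCLike.norm_conj, Nat.add_sub_cancel,
      Nat.sub_sub_self (Finset.mem_range_succ_iff.1 hi)]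
  calc ∑ k ∈ Finset.range N, ‖coeff k (p * φ)‖ ^ 2 + (‖coeff (N + l) (p * φ)‖ + s) ^ 2
      ≤ ∑ k ∈ Finset.range N, ‖coeff k ((p + PowerSeries.X ^ N * q) * φ)‖ ^ 2 +
        ∑ i ∈ Finset.range (l + 1), ‖coeff (N + i) ((p + PowerSeries.X ^ N * q) * φ)‖ ^ 2 := by
        refine add_le_add (Finset.sum_congr rfl fun k hk => by rw [hgφ, hlow hk]).le ?_
        rw [← htop]
        exact Finset.single_le_sum (f := fun i =>
          ‖coeff (N + i) ((p + PowerSeries.X ^ N * q) * φ)‖ ^ 2) (fun i _ => by positivity)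
          (Finset.self_mem_range_succ l)
    _ ≤ ∑ j ∈ Finset.range N, ‖coeff j (p + PowerSeries.X ^ N * q)‖ ^ 2 +
        ∑ i ∈ Finset.range (l + 1), ‖coeff (N + i) (p + PowerSeries.X ^ N * q)‖ ^ 2 := by
        simpa only [Finset.sum_range_add] using hφ.sum_sq_norm_coeff_mul_le hh _ (N + (l + 1))
    _ = ∑ j ∈ Finset.range N, ‖coeff j p‖ ^ 2 + s := by
        rw [hhigh, Finset.sum_congr rfl fun j hj => by rw [hlow hj]]

theorem norm_coeff_odd_add_sum_sq_le_one (hφ : HasDiskSeries φ h)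
    (hh : ∀ z : ℂ, ‖z‖ < 1 → ‖h z‖ ≤ 1) (n : ℕ) :
    ‖coeff (2 * n + 1) φ‖ + ∑ k ∈ Finset.range (n + 1), ‖coeff k φ‖ ^ 2 ≤ 1 := by
  have htest := hφ.sum_sq_norm_coeff_mul_add_sq_le hh (p := 1) (N := n + 1)
    (fun j hj => by simp [PowerSeries.coeff_one, Nat.ne_of_gt (Nat.zero_lt_of_lt hj)]) n
  have hone : ∑ j ∈ Finset.range (n + 1), ‖coeff j (1 : PowerSeries ℂ)‖ ^ 2 = 1 := by
    simp [PowerSeries.coeff_one, apply_ite]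
  rw [hone, one_mul, show n + 1 + n = 2 * n + 1 by ring] at htest
  refine le_of_abs_le (abs_le_one_iff_mul_self_le_one.2 ?_)
  linarith

theorem norm_coeff_even_add_sum_sq_le_one (hφ : HasDiskSeries φ h)
    (hh : ∀ z : ℂ, ‖z‖ < 1 → ‖h z‖ ≤ 1) (n : ℕ) :
    ‖coeff (2 * n + 2) φ‖ + ∑ k ∈ Finset.range (n + 1), ‖coeff k φ‖ ^ 2 +
      ‖coeff (n + 1) φ‖ ^ 2 / (1 + ‖coeff 0 φ‖) ≤ 1 := by
  obtain ⟨t, ht, htop⟩ : ∃ t : ℂ, ‖t‖ = 1 ∧ t * ‖coeff (2 * n + 2) φ‖ = coeff (2 * n + 2) φ :=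
    RCLike.exists_norm_mul_eq_self _
  obtain ⟨τ, hτ, hmid⟩ : ∃ τ : ℂ, ‖τ‖ = 1 ∧ ‖coeff (n + 1) φ‖ = τ * coeff (n + 1) φ :=
    RCLike.exists_norm_eq_mul_self _
  set m : ℝ := ‖coeff (n + 1) φ‖ / (1 + ‖coeff 0 φ‖)
  have hm : 0 ≤ m := by positivity
  have hm_eq : ‖coeff (n + 1) φ‖ - m * ‖coeff 0 φ‖ = m := by simp only [m]; field_simp; ring
  set μ : ℂ := t * m * τ
  have hμ : ‖μ‖ = m := by simp [μ, ht, hτ, abs_of_nonneg hm]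
  have htest := hφ.sum_sq_norm_coeff_mul_add_sq_le hh
    (p := 1 + PowerSeries.C μ * PowerSeries.X ^ (n + 1)) (N := n + 1 + 1)
    (fun j hj => by
      simp [PowerSeries.coeff_one, PowerSeries.coeff_X_pow, show j ≠ 0 by omega,
        show j ≠ n + 1 by omega]) n
  rw [sum_sq_norm_coeff_one_add_C_mul_X_pow_succ, sum_sq_norm_coeff_one_add_C_mul_X_pow_mul, hμ,
    coeff_one_add_C_mul_X_pow_mul, if_pos (by omega),
    show n + 1 + 1 + n = 2 * n + 2 by ring, show 2 * n + 2 - (n + 1) = n + 1 by omega] at htest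
  have hmid_ge : m ≤ ‖coeff (n + 1) φ + μ * coeff 0 φ‖ := by
    calc m = ‖coeff (n + 1) φ‖ - ‖μ * coeff 0 φ‖ := by rw [norm_mul, hμ, hm_eq]
      _ ≤ _ := norm_sub_le_norm_add _ _
  have htop_eq : ‖coeff (2 * n + 2) φ + μ * coeff (n + 1) φ‖ =
      ‖coeff (2 * n + 2) φ‖ + ‖coeff (n + 1) φ‖ ^ 2 / (1 + ‖coeff 0 φ‖) := by
    have haligned : coeff (2 * n + 2) φ + μ * coeff (n + 1) φ =
        t * ((‖coeff (2 * n + 2) φ‖ + m * ‖coeff (n + 1) φ‖ : ℝ) : ℂ) := by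
      conv_lhs => rw [← htop]
      push_cast
      linear_combination -(t * m) * hmid
    rw [haligned, norm_mul, ht, one_mul, Complex.norm_of_nonneg (by positivity)]
    simp only [m]
    ring
  rw [htop_eq] at htest
  have hsq : m ^ 2 ≤ ‖coeff (n + 1) φ + μ * coeff 0 φ‖ ^ 2 := by gcongr
  refine le_of_abs_le (abs_le_one_iff_mul_self_le_one.2 ?_)
  linarith

theorem sq_norm_coeff_succ_add_mul_sum_sq_le (hφ : HasDiskSeries φ h)
    (hh : ∀ z : ℂ, ‖z‖ < 1 → ‖h z‖ ≤ 1) (n : ℕ) :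
    ‖coeff (n + 1) φ‖ ^ 2 + (1 - ‖coeff 0 φ‖ ^ 2) * ∑ k ∈ Finset.range n, ‖coeff (k + 1) φ‖ ^ 2 ≤
      (1 - ‖coeff 0 φ‖ ^ 2) ^ 2 := by
  set D := 1 - ‖coeff 0 φ‖ ^ 2 with hD
  have hS : 0 ≤ ∑ k ∈ Finset.range n, ‖coeff (k + 1) φ‖ ^ 2 :=
    Finset.sum_nonneg fun k _ => by positivity
  have hβ (β : ℂ) : ‖coeff (n + 1) φ + β * coeff 0 φ‖ ^ 2 +
      ∑ k ∈ Finset.range n, ‖coeff (k + 1) φ‖ ^ 2 ≤ D + ‖β‖ ^ 2 := by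
    have htest := hφ.sum_sq_norm_coeff_mul_le hh
      (1 + PowerSeries.C β * PowerSeries.X ^ (n + 1)) (n + 1 + 1)
    rw [sum_sq_norm_coeff_one_add_C_mul_X_pow_succ, sum_sq_norm_coeff_one_add_C_mul_X_pow_mul,
      Finset.sum_range_succ'] at htest
    linarith
  have hD0 : 0 ≤ D := by
    have := hβ 0
    simp only [zero_mul, add_zero, norm_zero] at this
    nlinarith [norm_nonneg (coeff (n + 1) φ)]
  rcases hD0.eq_or_lt with hD0 | hD0
  · rw [← hD0]
    have := hβ 0
    simp only [zero_mul, add_zero, norm_zero] at this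
    nlinarith
  · have hopt : coeff (n + 1) φ + conj (coeff 0 φ) * coeff (n + 1) φ / D * coeff 0 φ =
        coeff (n + 1) φ / D := by
      have hDC : (D : ℂ) ≠ 0 := by exact_mod_cast hD0.ne'
      have hDsq : (D : ℂ) = 1 - conj (coeff 0 φ) * coeff 0 φ := by
        rw [Complex.conj_mul', hD]; push_cast; ring
      field_simp
      rw [hDsq]; ring
    have := hβ (conj (coeff 0 φ) * coeff (n + 1) φ / D)
    rw [hopt, norm_div, norm_div, norm_mul, RCLike.norm_conj, Complex.norm_of_nonneg hD0.le] at this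
    field_simp at this
    nlinarith

theorem sum_sq_norm_coeff_succ_le (hφ : HasDiskSeries φ h)
    (hh : ∀ z : ℂ, ‖z‖ < 1 → ‖h z‖ ≤ 1) (n : ℕ) :
    ∑ k ∈ Finset.range n, ‖coeff (k + 1) φ‖ ^ 2 ≤
      ∑ k ∈ Finset.range n, (1 - ‖coeff 0 φ‖ ^ 2) ^ 2 * (‖coeff 0 φ‖ ^ 2) ^ k := by
  induction n with
  | zero => simp
  | succ n ih =>
    have hstep := hφ.sq_norm_coeff_succ_add_mul_sum_sq_le hh n
    calc ∑ k ∈ Finset.range (n + 1), ‖coeff (k + 1) φ‖ ^ 2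
        ≤ (1 - ‖coeff 0 φ‖ ^ 2) ^ 2 +
          ‖coeff 0 φ‖ ^ 2 * ∑ k ∈ Finset.range n, ‖coeff (k + 1) φ‖ ^ 2 := by
          rw [Finset.sum_range_succ]
          linarith
      _ ≤ (1 - ‖coeff 0 φ‖ ^ 2) ^ 2 + ‖coeff 0 φ‖ ^ 2 *
          ∑ k ∈ Finset.range n, (1 - ‖coeff 0 φ‖ ^ 2) ^ 2 * (‖coeff 0 φ‖ ^ 2) ^ k := by gcongr
      _ = _ := by
          rw [Finset.sum_range_succ', Finset.mul_sum, add_comm]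
          simp only [pow_succ', pow_zero, mul_one, mul_left_comm]

end HasDiskSeries

section RealSeries

theorem hasSum_sum_range_succ_mul_pow {B : ℕ → ℝ} {q S : ℝ} (hq : 0 ≤ q) (hq1 : q < 1)
    (hS : HasSum (fun n => B n * q ^ n) S) :
    HasSum (fun n => (∑ k ∈ Finset.range (n + 1), B k) * q ^ n) (S * (1 - q)⁻¹) := by
  have hcauchy := hasSum_sum_range_mul_of_summable_norm hS.summable.norm
    (summable_geometric_of_lt_one hq hq1).norm
  rw [hS.tsum_eq, tsum_geometric_of_lt_one hq hq1] at hcauchy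
  refine hcauchy.congr_fun fun n => ?_
  rw [Finset.sum_mul]
  refine Finset.sum_congr rfl fun k hk => ?_
  rw [mul_assoc, ← pow_add, Nat.add_sub_cancel' (Finset.mem_range_succ_iff.1 hk)]

theorem sum_mul_le_sum_mul_of_antitone {w A B : ℕ → ℝ} (hw : Antitone w) (hw0 : ∀ n, 0 ≤ w n)
    (hAB : ∀ n, ∑ k ∈ Finset.range n, A k ≤ ∑ k ∈ Finset.range n, B k) (n : ℕ) :
    ∑ k ∈ Finset.range n, w k * A k ≤ ∑ k ∈ Finset.range n, w k * B k := by
  have habel (n : ℕ) : w n * (∑ k ∈ Finset.range n, B k - ∑ k ∈ Finset.range n, A k) ≤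
      ∑ k ∈ Finset.range n, w k * B k - ∑ k ∈ Finset.range n, w k * A k := by
    induction n with
    | zero => simp
    | succ n ih =>
      refine (mul_le_mul_of_nonneg_right (hw n.le_succ) (sub_nonneg.2 (hAB (n + 1)))).trans ?_
      simp only [Finset.sum_range_succ]
      linarith
  linarith [habel n, mul_nonneg (hw0 n) (sub_nonneg.2 (hAB n))]

theorem antitone_succ_mul_pow_succ {q : ℝ} (hq : 0 ≤ q) (hq2 : q ≤ 1 / 2) :
    Antitone fun n : ℕ => (n + 1) * q ^ (n + 1) := by
  refine antitone_nat_of_succ_le fun n => ?_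
  calc ((n + 1 : ℕ) + 1) * q ^ (n + 1 + 1) = ((n + 2) * q) * q ^ (n + 1) := by push_cast; ring
    _ ≤ (n + 1) * q ^ (n + 1) := by
      gcongr
      nlinarith [n.cast_nonneg (α := ℝ)]

theorem hasSum_succ_mul_geometric {x : ℝ} (hx : |x| < 1) :
    HasSum (fun n : ℕ => (n + 1) * x ^ n) (1 / (1 - x) ^ 2) := by
  simpa only [Nat.choose_one_right, Nat.cast_add, Nat.cast_one] using
    hasSum_choose_mul_geometric_of_norm_lt_one 1 (by rwa [Real.norm_eq_abs])

end RealSeries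

namespace HasDiskSeries

variable {φ : PowerSeries ℂ} {h : ℂ → ℂ} {r : ℝ}

theorem tsum_norm_coeff_succ_add_le (hφ : HasDiskSeries φ h) (hh : ∀ z : ℂ, ‖z‖ < 1 → ‖h z‖ ≤ 1)
    (hr : 0 ≤ r) (hr1 : r < 1) :
    ∑' n, ‖coeff (n + 1) φ‖ * r ^ (n + 1) + (1 / (1 + ‖coeff 0 φ‖) + r / (1 - r)) *
        ∑' n, ‖coeff (n + 1) φ‖ ^ 2 * r ^ (2 * (n + 1)) ≤
      (1 - ‖coeff 0 φ‖ ^ 2) * (r / (1 - r)) := by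
  set A : ℕ → ℝ := fun n => ‖coeff n φ‖
  have hr2 : r ^ 2 < 1 := by nlinarith
  have hsum : Summable fun n => A n * r ^ n := hφ.summable_norm hr hr1
  have hsq : Summable fun n => A n ^ 2 * r ^ (2 * n) := (hφ.hasSum_sq_norm_coeff hr hr1).summable
  have htail : Summable fun n => A (n + 1) ^ 2 * r ^ (2 * (n + 1)) := (summable_nat_add_iff 1).2 hsq
  set Q := ∑' n, A (n + 1) ^ 2 * r ^ (2 * (n + 1))
  have hodd : Summable fun n => A (2 * n + 1) * r ^ (2 * n + 1) :=
    hsum.comp_injective fun m n hmn => by simpa using hmn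
  have heven : Summable fun n => A (2 * n + 2) * r ^ (2 * n + 2) :=
    hsum.comp_injective fun m n hmn => by simpa using hmn
  have hpartial : HasSum (fun n => (∑ k ∈ Finset.range (n + 1), A k ^ 2) * (r ^ 2) ^ n)
      ((A 0 ^ 2 + Q) * (1 - r ^ 2)⁻¹) := by
    refine hasSum_sum_range_succ_mul_pow (sq_nonneg r) hr2 ?_
    have hQ : A 0 ^ 2 + Q = ∑' n, A n ^ 2 * r ^ (2 * n) := by
      rw [hsq.tsum_eq_zero_add, mul_zero, pow_zero, mul_one]
    simpa only [hQ, pow_mul] using hsq.hasSum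
  have hmajorant :=
    ((hasSum_geometric_of_lt_one (sq_nonneg r) hr2).sub hpartial).mul_left (r + r ^ 2)
  have hcarlson : ∑' n, A (n + 1) * r ^ (n + 1) + 1 / (1 + A 0) * Q ≤
      (r + r ^ 2) * ((1 - r ^ 2)⁻¹ - (A 0 ^ 2 + Q) * (1 - r ^ 2)⁻¹) := by
    rw [← tsum_even_add_odd (f := fun n => A (n + 1) * r ^ (n + 1)) hodd heven,
      ← hodd.tsum_add heven, ← tsum_mul_left, ← (hodd.add heven).tsum_add (htail.mul_left _)]
    refine hasSum_le (fun n => ?_) ((hodd.add heven).add (htail.mul_left _)).hasSum hmajorant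
    have hodd_le := mul_le_mul_of_nonneg_right (hφ.norm_coeff_odd_add_sum_sq_le_one hh n)
      (pow_nonneg hr (2 * n + 1))
    have heven_le := mul_le_mul_of_nonneg_right (hφ.norm_coeff_even_add_sum_sq_le_one hh n)
      (pow_nonneg hr (2 * n + 2))
    rw [← pow_mul, one_div_mul_eq_div]
    change _ + (A (n + 1) ^ 2 * _) / _ ≤ _
    rw [mul_div_right_comm]
    linear_combination hodd_le + heven_le
  have hgeom : (r + r ^ 2) * (1 - r ^ 2)⁻¹ = r / (1 - r) := by
    rw [← div_eq_mul_inv, div_eq_div_iff (by linarith) (by linarith)]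
    ring
  linear_combination hcarlson + (1 - A 0 ^ 2 - Q) * hgeom

theorem sum_succ_mul_sq_norm_coeff_le (hφ : HasDiskSeries φ h)
    (hh : ∀ z : ℂ, ‖z‖ < 1 → ‖h z‖ ≤ 1) {q : ℝ} (hq : 0 ≤ q) (hq2 : q ≤ 1 / 2) (n : ℕ) :
    ∑ k ∈ Finset.range n, (k + 1) * ‖coeff (k + 1) φ‖ ^ 2 * q ^ (k + 1) ≤
      (1 - ‖coeff 0 φ‖ ^ 2) ^ 2 * q / (1 - ‖coeff 0 φ‖ ^ 2 * q) ^ 2 := by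
  set a := ‖coeff 0 φ‖
  have ha1 : a ≤ 1 := by simpa [a, ← hφ.apply_zero] using hh 0 (by simp)
  have hx : |a ^ 2 * q| < 1 := by
    rw [abs_of_nonneg (by positivity)]
    nlinarith [pow_le_one₀ (n := 2) (norm_nonneg (coeff 0 φ)) ha1]
  have hgeom : HasSum (fun k : ℕ => (k + 1) * q ^ (k + 1) * ((1 - a ^ 2) ^ 2 * (a ^ 2) ^ k))
      ((1 - a ^ 2) ^ 2 * q / (1 - a ^ 2 * q) ^ 2) := by
    rw [← mul_one_div]
    refine ((hasSum_succ_mul_geometric hx).mul_left _).congr_fun fun k => ?_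
    ring
  calc ∑ k ∈ Finset.range n, (k + 1) * ‖coeff (k + 1) φ‖ ^ 2 * q ^ (k + 1)
      = ∑ k ∈ Finset.range n, (k + 1) * q ^ (k + 1) * ‖coeff (k + 1) φ‖ ^ 2 :=
        Finset.sum_congr rfl fun k _ => by ring
    _ ≤ ∑ k ∈ Finset.range n, (k + 1) * q ^ (k + 1) * ((1 - a ^ 2) ^ 2 * (a ^ 2) ^ k) :=
        sum_mul_le_sum_mul_of_antitone (antitone_succ_mul_pow_succ hq hq2)
          (fun k => by positivity) (hφ.sum_sq_norm_coeff_succ_le hh) n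
    _ ≤ (1 - a ^ 2) ^ 2 * q / (1 - a ^ 2 * q) ^ 2 :=
        sum_le_hasSum _ (fun k _ => by positivity) hgeom

end HasDiskSeries

section AreaFormula

theorem encard_iUnion_inter_preimage_singleton {α β : Type*} {f : α → β} {D : ℕ → Set α}
    (hdisj : Pairwise (Function.onFun Disjoint D)) (hinj : ∀ n, Set.InjOn f (D n)) (w : β) :
    ((((⋃ n, D n) ∩ f ⁻¹' {w}).encard : ℕ∞) : ℝ≥0∞) = ∑' n, (f '' D n).indicator 1 w := by
  let _ : MeasurableSpace α := ⊤
  rw [Set.iUnion_inter, ← Measure.count_apply MeasurableSpace.measurableSet_top, measure_iUnion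
    (fun m n hmn => (hdisj hmn).mono Set.inter_subset_left Set.inter_subset_left)
    fun _ => MeasurableSpace.measurableSet_top]
  refine tsum_congr fun n => ?_
  have hsub : (D n ∩ f ⁻¹' {w}).Subsingleton := fun x hx y hy =>
    hinj n hx.1 hy.1 (hx.2.trans hy.2.symm)
  rw [Measure.count_apply MeasurableSpace.measurableSet_top]
  by_cases hw : w ∈ f '' D n
  · obtain ⟨z, hz, rfl⟩ := hw
    rw [hsub.eq_singleton_of_mem ⟨hz, rfl⟩, Set.indicator_of_mem (Set.mem_image_of_mem f hz)]
    simp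
  · have hempty : D n ∩ f ⁻¹' {w} = ∅ :=
      Set.eq_empty_of_forall_notMem fun z hz => hw ⟨z, hz.1, hz.2⟩
    simp [hempty, Set.indicator_of_notMem hw]

variable {E : Type*} [NormedAddCommGroup E] [NormedSpace ℝ E] [FiniteDimensional ℝ E]
  {f : E → E} {f' : E → E →L[ℝ] E} {s : Set E}

theorem exists_forall_approximatesLinearOn_injOn (f : E → E) {A : E →L[ℝ] E} (hA : A.det ≠ 0) :
    ∃ δ : NNReal, δ ≠ 0 ∧ ∀ t : Set E, ApproximatesLinearOn f A t δ → Set.InjOn f t := by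
  set B := A.toContinuousLinearEquivOfDetNeZero hA
  have hB : (B : E →L[ℝ] E) = A := A.coe_toContinuousLinearEquivOfDetNeZero hA
  rcases B.subsingleton_or_nnnorm_symm_pos with hE | hpos
  · exact ⟨1, one_ne_zero, fun t _ => Set.injOn_of_subsingleton f t⟩
  · refine ⟨‖(B.symm : E →L[ℝ] E)‖₊⁻¹ / 2, (half_pos (inv_pos.2 hpos)).ne', fun t ht => ?_⟩
    rw [← hB] at ht
    exact ht.injOn (.inr (half_lt_self (inv_pos.2 hpos)))

variable [MeasurableSpace E] [BorelSpace E]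

theorem exists_partition_injOn_of_det_ne_zero
    (hf' : ∀ x ∈ s, HasFDerivWithinAt f (f' x) s x) (hdet : ∀ x ∈ s, (f' x).det ≠ 0) :
    ∃ t : ℕ → Set E, Pairwise (Function.onFun Disjoint t) ∧ (∀ n, MeasurableSet (t n)) ∧
      s ⊆ ⋃ n, t n ∧ ∀ n, Set.InjOn f (s ∩ t n) := by
  have hδ (A : E →L[ℝ] E) : ∃ δ : NNReal, δ ≠ 0 ∧
      (A.det ≠ 0 → ∀ t : Set E, ApproximatesLinearOn f A t δ → Set.InjOn f t) := by
    by_cases hA : A.det = 0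
    · exact ⟨1, one_ne_zero, fun h => (h hA).elim⟩
    · obtain ⟨δ, hδ0, hδ⟩ := exists_forall_approximatesLinearOn_injOn f hA
      exact ⟨δ, hδ0, fun _ => hδ⟩
  choose δ hδ0 hδ using hδ
  obtain ⟨t, A, hdisj, hmeas, hcover, happrox, hA⟩ :=
    exists_partition_approximatesLinearOn_of_hasFDerivWithinAt f s f' hf' δ hδ0
  refine ⟨t, hdisj, hmeas, hcover, fun n => ?_⟩
  rcases s.eq_empty_or_nonempty with rfl | hs
  · simp
  · obtain ⟨y, hy, hAy⟩ := hA hs n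
    exact hδ (A n) (hAy ▸ hdet y hy) _ (happrox n)

variable (μ : Measure E) [μ.IsAddHaarMeasure]

theorem lintegral_encard_inter_preimage_eq_of_det_ne_zero (hs : NullMeasurableSet s μ)
    (hf' : ∀ x ∈ s, HasFDerivWithinAt f (f' x) s x) (hdet : ∀ x ∈ s, (f' x).det ≠ 0) :
    ∫⁻ w, (((s ∩ f ⁻¹' {w}).encard : ℕ∞) : ℝ≥0∞) ∂μ =
      ∫⁻ x in s, ENNReal.ofReal |(f' x).det| ∂μ := by
  obtain ⟨t, hdisj, hmeas, hcover, hinj⟩ := exists_partition_injOn_of_det_ne_zero hf' hdet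
  have hs_eq : ⋃ n, s ∩ t n = s := by rw [← Set.inter_iUnion, Set.inter_eq_left.2 hcover]
  have hdisj' : Pairwise (Function.onFun Disjoint fun n => s ∩ t n) := fun m n hmn =>
    (hdisj hmn).mono Set.inter_subset_right Set.inter_subset_right
  have hpiece (n) : NullMeasurableSet (s ∩ t n) μ := hs.inter (hmeas n).nullMeasurableSet
  have hpiece' (n) : ∀ x ∈ s ∩ t n, HasFDerivWithinAt f (f' x) (s ∩ t n) x := fun x hx =>
    (hf' x hx.1).mono Set.inter_subset_left
  have himage (n) : NullMeasurableSet (f '' (s ∩ t n)) μ :=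
    nullMeasurable_image_of_fderivWithin μ (hpiece n) (hpiece' n) (hinj n)
  calc ∫⁻ w, (((s ∩ f ⁻¹' {w}).encard : ℕ∞) : ℝ≥0∞) ∂μ
      = ∫⁻ w, ∑' n, (f '' (s ∩ t n)).indicator 1 w ∂μ := by
        simp_rw [← encard_iUnion_inter_preimage_singleton hdisj' hinj, hs_eq]
    _ = ∑' n, μ (f '' (s ∩ t n)) := by
        rw [lintegral_tsum fun n => measurable_one.aemeasurable.indicator₀ (himage n)]
        exact tsum_congr fun n => lintegral_indicator_one₀ (himage n)
    _ = ∑' n, ∫⁻ x in s ∩ t n, ENNReal.ofReal |(f' x).det| ∂μ := tsum_congr fun n =>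
        (lintegral_abs_det_fderiv_eq_addHaar_image₀ μ (hpiece n) (hpiece' n) (hinj n)).symm
    _ = ∫⁻ x in s, ENNReal.ofReal |(f' x).det| ∂μ := by
        rw [← lintegral_iUnion₀ hpiece hdisj'.aedisjoint, hs_eq]

theorem lintegral_encard_inter_preimage_eq_lintegral_abs_det (hs : MeasurableSet s)
    (hf' : ∀ x ∈ s, HasFDerivWithinAt f (f' x) s x) :
    ∫⁻ w, (((s ∩ f ⁻¹' {w}).encard : ℕ∞) : ℝ≥0∞) ∂μ =
      ∫⁻ x in s, ENNReal.ofReal |(f' x).det| ∂μ := by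
  set R := {x | (f' x).det ≠ 0}
  have hR : NullMeasurableSet (R ∩ s) μ := by
    rw [← nullMeasurableSet_restrict hs.nullMeasurableSet]
    exact (ContinuousLinearMap.continuous_det.measurable.comp_aemeasurable
      (aemeasurable_fderivWithin μ hs hf')).nullMeasurableSet_preimage
        (measurableSet_singleton 0).compl
  have hcritical : μ (f '' (s \ R)) = 0 := addHaar_image_eq_zero_of_det_fderivWithin_eq_zero μ
    (fun x hx => (hf' x hx.1).mono Set.sdiff_subset) fun x hx => not_not.1 hx.2
  calc ∫⁻ w, (((s ∩ f ⁻¹' {w}).encard : ℕ∞) : ℝ≥0∞) ∂μ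
      = ∫⁻ w, (((R ∩ s ∩ f ⁻¹' {w}).encard : ℕ∞) : ℝ≥0∞) ∂μ := by
        refine lintegral_congr_ae ?_
        filter_upwards [compl_mem_ae_iff.2 hcritical] with w hw
        congr 2
        ext x
        exact ⟨fun hx => ⟨⟨not_not.1 fun hxR => hw ⟨x, ⟨hx.1, hxR⟩, hx.2⟩, hx.1⟩, hx.2⟩,
          fun hx => ⟨hx.1.2, hx.2⟩⟩
    _ = ∫⁻ x in R ∩ s, ENNReal.ofReal |(f' x).det| ∂μ :=
        lintegral_encard_inter_preimage_eq_of_det_ne_zero μ hR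
          (fun x hx => (hf' x hx.2).mono Set.inter_subset_right) fun x hx => hx.1
    _ = ∫⁻ x in s, ENNReal.ofReal |(f' x).det| ∂μ := by
        rw [← lintegral_indicator₀ hR, ← lintegral_indicator hs]
        refine lintegral_congr fun x => ?_
        classical by_cases hx : (f' x).det = 0 <;> simp [Set.indicator_apply, R, hx]

theorem lintegral_encard_inter_preimage_eq_lintegral_sq_norm_deriv {f : ℂ → ℂ} {s : Set ℂ}
    (hs : MeasurableSet s) (hf : ∀ z ∈ s, DifferentiableAt ℂ f z) :
    ∫⁻ w, (((s ∩ f ⁻¹' {w}).encard : ℕ∞) : ℝ≥0∞) =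
      ∫⁻ z in s, ENNReal.ofReal (‖deriv f z‖ ^ 2) := by
  have hdet (a : ℂ) :
      |((ContinuousLinearMap.toSpanSingleton ℂ a).restrictScalars ℝ).det| = ‖a‖ ^ 2 := by
    simp [ContinuousLinearMap.det, LinearMap.det_restrictScalars, Algebra.norm_complex_eq,
      Complex.normSq_eq_norm_sq]
  simp_rw [← hdet]
  exact lintegral_encard_inter_preimage_eq_lintegral_abs_det volume hs fun z hz =>
    ((hf z hz).hasDerivAt.hasFDerivAt.restrictScalars ℝ).hasFDerivWithinAt

end AreaFormula

section PolarCoordinates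

variable {u : ℂ → ℝ} {r : ℝ}

theorem lintegral_ball_eq_lintegral_polar (hu : ContinuousOn u (Metric.ball 0 r)) :
    ∫⁻ z in Metric.ball (0 : ℂ) r, ENNReal.ofReal (u z) = ∫⁻ ρ in Set.Ioo 0 r, ENNReal.ofReal ρ *
      ∫⁻ θ in Set.Ioo (-Real.pi) Real.pi, ENNReal.ofReal (u (circleMap 0 ρ θ)) := by
  set S : Set (ℝ × ℝ) := Set.Ioo 0 r ×ˢ Set.Ioo (-Real.pi) Real.pi
  have hS : MeasurableSet S := measurableSet_Ioo.prod measurableSet_Ioo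
  have hsub : S ⊆ polarCoord.target := fun p hp => ⟨hp.1.1, hp.2⟩
  have hsymm (p : ℝ × ℝ) : Complex.polarCoord.symm p = circleMap 0 p.1 p.2 := by
    simp [circleMap, Complex.exp_mul_I]
  have hmem (p : ℝ × ℝ) (hp : p ∈ polarCoord.target) :
      circleMap 0 p.1 p.2 ∈ Metric.ball (0 : ℂ) r ↔ p ∈ S := by
    have h0 : 0 < p.1 := hp.1
    have hθ : p.2 ∈ Set.Ioo (-Real.pi) Real.pi := hp.2
    simp [S, abs_of_pos h0, h0, hθ.1, hθ.2]
  have hcont : ContinuousOn (fun p : ℝ × ℝ => u (circleMap 0 p.1 p.2)) S :=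
    hu.comp (by unfold circleMap; fun_prop) fun p hp => (hmem p (hsub hp)).2 hp
  have hmeas : AEMeasurable
      (fun p : ℝ × ℝ => ENNReal.ofReal p.1 * ENNReal.ofReal (u (circleMap 0 p.1 p.2)))
      ((volume.prod volume).restrict S) :=
    (continuousOn_fst.aemeasurable hS).ennreal_ofReal.mul (hcont.aemeasurable hS).ennreal_ofReal
  calc ∫⁻ z in Metric.ball (0 : ℂ) r, ENNReal.ofReal (u z)
      = ∫⁻ p in polarCoord.target, ENNReal.ofReal p.1 •
          (Metric.ball (0 : ℂ) r).indicator (fun z => ENNReal.ofReal (u z))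
            (Complex.polarCoord.symm p) := by
        rw [Complex.lintegral_comp_polarCoord_symm,
          lintegral_indicator Metric.isOpen_ball.measurableSet]
    _ = ∫⁻ p in polarCoord.target, S.indicator
          (fun p => ENNReal.ofReal p.1 * ENNReal.ofReal (u (circleMap 0 p.1 p.2))) p := by
        refine setLIntegral_congr_fun polarCoord.open_target.measurableSet fun p hp => ?_
        classical simp [Set.indicator_apply, hsymm, hmem p hp]
    _ = ∫⁻ p in S, ENNReal.ofReal p.1 * ENNReal.ofReal (u (circleMap 0 p.1 p.2)) := by
        rw [setLIntegral_indicator hS, Set.inter_eq_left.2 hsub]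
    _ = ∫⁻ ρ in Set.Ioo 0 r, ENNReal.ofReal ρ *
          ∫⁻ θ in Set.Ioo (-Real.pi) Real.pi, ENNReal.ofReal (u (circleMap 0 ρ θ)) := by
        rw [Measure.volume_eq_prod, setLIntegral_prod _ hmeas]
        simp_rw [lintegral_const_mul' _ _ ENNReal.ofReal_ne_top]

theorem lintegral_circleMap_eq_circleAverage (hu : CircleIntegrable u 0 r) (hu0 : ∀ z, 0 ≤ u z) :
    ∫⁻ θ in Set.Ioo (-Real.pi) Real.pi, ENNReal.ofReal (u (circleMap 0 r θ)) =
      ENNReal.ofReal (2 * Real.pi * circleAverage u 0 r) := by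
  have hper : Function.Periodic (fun θ => u (circleMap 0 r θ)) (2 * Real.pi) :=
    (periodic_circleMap 0 r).comp u
  have hint : IntervalIntegrable (fun θ => u (circleMap 0 r θ)) volume (-Real.pi) Real.pi :=
    hper.intervalIntegrable₀ Real.two_pi_pos.ne' hu _ _
  have hshift : ∫ θ in -Real.pi..Real.pi, u (circleMap 0 r θ) =
      ∫ θ in 0..2 * Real.pi, u (circleMap 0 r θ) := by
    convert hper.intervalIntegral_add_eq (-Real.pi) 0 using 2 <;> ring
  rw [setLIntegral_congr Ioo_ae_eq_Ioc, ← ofReal_integral_eq_lintegral_ofReal hint.1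
    (ae_of_all _ fun θ => hu0 _), ← intervalIntegral.integral_of_le (by linarith [Real.pi_pos]),
    hshift, Real.circleAverage_def, smul_eq_mul, mul_inv_cancel_left₀ Real.two_pi_pos.ne']

end PolarCoordinates

theorem lintegral_Ioo_pow (k : ℕ) {r : ℝ} (hr : 0 ≤ r) :
    ∫⁻ ρ in Set.Ioo 0 r, ENNReal.ofReal (ρ ^ k) = ENNReal.ofReal (r ^ (k + 1) / (k + 1)) := by
  have hint : IntervalIntegrable (fun ρ : ℝ => ρ ^ k) volume 0 r :=
    (continuous_pow k).intervalIntegrable _ _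
  have hnonneg : 0 ≤ᵐ[volume.restrict (Set.Ioc 0 r)] fun ρ : ℝ => ρ ^ k :=
    ae_restrict_of_forall_mem measurableSet_Ioc fun ρ hρ => pow_nonneg hρ.1.le k
  rw [setLIntegral_congr Ioo_ae_eq_Ioc, ← ofReal_integral_eq_lintegral_ofReal hint.1 hnonneg,
    ← intervalIntegral.integral_of_le hr, integral_pow, zero_pow k.succ_ne_zero, sub_zero]

namespace HasDiskSeries

variable {φ : PowerSeries ℂ} {h : ℂ → ℂ} {r : ℝ}

theorem summable_sq_norm_coeff_mul_pow_div (hφ : HasDiskSeries φ h) (hr : 0 ≤ r) (hr1 : r < 1) :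
    Summable fun n : ℕ => ‖coeff n φ‖ ^ 2 * r ^ (2 * (n + 1)) / (n + 1) := by
  refine .of_nonneg_of_le (fun n => by positivity) (fun n => ?_)
    (hφ.hasSum_sq_norm_coeff hr hr1).summable
  calc ‖coeff n φ‖ ^ 2 * r ^ (2 * (n + 1)) / (n + 1)
      ≤ ‖coeff n φ‖ ^ 2 * r ^ (2 * (n + 1)) := div_le_self (by positivity) (by simp)
    _ ≤ ‖coeff n φ‖ ^ 2 * r ^ (2 * n) := mul_le_mul_of_nonneg_left
        (pow_le_pow_of_le_one hr hr1.le (by lia)) (by positivity)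

theorem lintegral_ball_sq_norm (hφ : HasDiskSeries φ h) (hr : 0 ≤ r) (hr1 : r < 1) :
    ∫⁻ z in Metric.ball (0 : ℂ) r, ENNReal.ofReal (‖h z‖ ^ 2) =
      ENNReal.ofReal (Real.pi * ∑' n : ℕ, ‖coeff n φ‖ ^ 2 * r ^ (2 * (n + 1)) / (n + 1)) := by
  have hcont : ContinuousOn (fun z => ‖h z‖ ^ 2) (Metric.closedBall 0 r) :=
    (hφ.continuousOn hr hr1).norm.pow 2
  have hcircle (ρ : ℝ) (hρ : ρ ∈ Set.Ioo 0 r) : ENNReal.ofReal ρ *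
      ∫⁻ θ in Set.Ioo (-Real.pi) Real.pi, ENNReal.ofReal (‖h (circleMap 0 ρ θ)‖ ^ 2) =
        ∑' n : ℕ, ENNReal.ofReal (2 * Real.pi * ‖coeff n φ‖ ^ 2) *
          ENNReal.ofReal (ρ ^ (2 * n + 1)) := by
    have hρ0 : 0 ≤ ρ := hρ.1.le
    have hsum := hφ.hasSum_sq_norm_coeff hρ0 (hρ.2.trans hr1)
    have hint : CircleIntegrable (fun z => ‖h z‖ ^ 2) 0 ρ :=
      (hcont.mono <| Metric.sphere_subset_closedBall.trans
        (Metric.closedBall_subset_closedBall hρ.2.le)).circleIntegrable hρ0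
    rw [lintegral_circleMap_eq_circleAverage hint fun z => by positivity, ← hsum.tsum_eq,
      ← ENNReal.ofReal_mul hρ0, ← tsum_mul_left, ← tsum_mul_left,
      ENNReal.ofReal_tsum_of_nonneg (fun n => by positivity)
        ((hsum.summable.mul_left _).mul_left _)]
    refine tsum_congr fun n => ?_
    rw [← ENNReal.ofReal_mul (by positivity)]
    ring_nf
  rw [lintegral_ball_eq_lintegral_polar (hcont.mono Metric.ball_subset_closedBall),
    setLIntegral_congr_fun measurableSet_Ioo hcircle, lintegral_tsum fun n => by fun_prop,
    ← tsum_mul_left, ENNReal.ofReal_tsum_of_nonneg (fun n => by positivity)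
      ((hφ.summable_sq_norm_coeff_mul_pow_div hr hr1).mul_left _)]
  refine tsum_congr fun n => ?_
  rw [lintegral_const_mul _ (by fun_prop), lintegral_Ioo_pow _ hr,
    ← ENNReal.ofReal_mul (by positivity)]
  congr 1
  push_cast
  field_simp
  ring

end HasDiskSeries

section TaylorSeries

variable {f : ℂ → ℂ} {r : ℝ}

/-- The Taylor series of `f` at the origin, as a formal power series, so that products of analytic
functions become products of series. -/
noncomputable def taylorSeries (f : ℂ → ℂ) : PowerSeries ℂ :=
  PowerSeries.mk (taylorCoeff f)

theorem coeff_taylorSeries (f : ℂ → ℂ) (n : ℕ) : coeff n (taylorSeries f) = taylorCoeff f n :=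
  PowerSeries.coeff_mk n _

theorem taylorCoeff_deriv (f : ℂ → ℂ) (n : ℕ) :
    taylorCoeff (deriv f) n = (n + 1) * taylorCoeff f (n + 1) := by
  rw [taylorCoeff, taylorCoeff, ← iteratedDeriv_succ', Nat.factorial_succ]
  push_cast
  field_simp

theorem hasDiskSeries_taylorSeries (hf : DifferentiableOn ℂ f (Metric.ball 0 1)) :
    HasDiskSeries (taylorSeries f) f := by
  intro z hz
  refine (Complex.hasSum_taylorSeries_on_ball hf (mem_ball_zero_iff.2 hz)).congr_fun fun n => ?_
  rw [coeff_taylorSeries, taylorCoeff, sub_zero, smul_eq_mul, smul_eq_mul]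
  ring

theorem imageArea_eq_ofReal_pi_mul_tsum (hf : AnalyticOnNhd ℂ f (Metric.ball 0 1)) (hr : 0 ≤ r)
    (hr1 : r < 1) : imageArea f r = ENNReal.ofReal (Real.pi *
      ∑' n : ℕ, (n + 1) * ‖taylorCoeff f (n + 1)‖ ^ 2 * (r ^ 2) ^ (n + 1)) := by
  have hdiff : ∀ z ∈ Metric.ball (0 : ℂ) r, DifferentiableAt ℂ f z := fun z hz =>
    (hf z (Metric.ball_subset_ball hr1.le hz)).differentiableAt
  have hderiv := hasDiskSeries_taylorSeries hf.deriv.differentiableOn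
  calc imageArea f r
      = ∫⁻ z in Metric.ball (0 : ℂ) r, ENNReal.ofReal (‖deriv f z‖ ^ 2) :=
        lintegral_encard_inter_preimage_eq_lintegral_sq_norm_deriv
          Metric.isOpen_ball.measurableSet hdiff
    _ = _ := hderiv.lintegral_ball_sq_norm hr hr1
    _ = _ := by
        congr 2
        refine tsum_congr fun n => ?_
        rw [coeff_taylorSeries, taylorCoeff_deriv, norm_mul, ← Nat.cast_succ, Complex.norm_natCast,
          Nat.cast_succ, ← pow_mul]
        field_simp

end TaylorSeries

/-- Upper bound, for self-maps with `|f 0| = a`, of the refined Bohr sums stripped of their initial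
terms `|a₀|` and `|a₀|²`: the first summand bounds the coefficient part, the second the area part.
It is attained by `(a - z) / (1 - a z)`. -/
noncomputable def bohrTailBound (c a r : ℝ) : ℝ :=
  (1 - a ^ 2) * (r / (1 - r)) + c * ((1 - a ^ 2) ^ 2 * r ^ 2 / (1 - a ^ 2 * r ^ 2) ^ 2)

theorem bohrTailBound_le_bohrTailBound {c a r R : ℝ} (hc : 0 ≤ c) (ha : 0 ≤ a) (ha1 : a < 1)
    (hr : 0 ≤ r) (hrR : r ≤ R) (hR : R < 1) : bohrTailBound c a r ≤ bohrTailBound c a R := by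
  have ha2 : 0 ≤ 1 - a ^ 2 := by nlinarith
  have hR2 : 0 < 1 - a ^ 2 * R ^ 2 := by nlinarith [sq_nonneg a, sq_nonneg R]
  have hR1 : 0 < 1 - R := sub_pos.2 hR
  have hR0 : 0 ≤ R := hr.trans hrR
  unfold bohrTailBound
  gcongr

theorem one_sub_add_bohrTailBound_one_third (c : ℝ) {a : ℝ} (ha : a ^ 2 < 9) :
    1 - (a + bohrTailBound c a (1 / 3)) =
      (1 - a) ^ 2 * ((9 - a ^ 2) ^ 2 - 18 * c * (1 + a) ^ 2) / (2 * (9 - a ^ 2) ^ 2) := by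
  have ha9 : 9 - a ^ 2 ≠ 0 := (sub_pos.2 ha).ne'
  rw [bohrTailBound, show 1 - a ^ 2 * (1 / 3) ^ 2 = (9 - a ^ 2) / 9 by ring]
  field_simp
  ring

theorem add_bohrTailBound_one_third_le_one {a : ℝ} (ha : 0 ≤ a) (ha1 : a < 1) :
    a + bohrTailBound (8 / 9) a (1 / 3) ≤ 1 := by
  have ha9 : 4 * (1 + a) ≤ 9 - a ^ 2 := by nlinarith
  have hsq : 0 ≤ (9 - a ^ 2) ^ 2 - 18 * (8 / 9) * (1 + a) ^ 2 := by nlinarith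
  rw [← sub_nonneg, one_sub_add_bohrTailBound_one_third _ (by linarith)]
  positivity

theorem one_sub_sq_add_bohrTailBound (c : ℝ) {a : ℝ} (ha1 : a < 1) :
    1 - (a ^ 2 + bohrTailBound c a (1 / (3 - a))) =
      (1 - a) ^ 2 * (1 + a) * (9 * (3 - 2 * a) ^ 2 - c * ((1 + a) * (3 - a) ^ 2 * (2 - a))) /
        (9 * (3 - 2 * a) ^ 2 * (2 - a)) := by
  have h3a : 3 - a ≠ 0 := by linarith
  have h2a : 2 - a ≠ 0 := by linarith
  have h32a : 3 - 2 * a ≠ 0 := by linarith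
  have hlin : 1 / (3 - a) / (1 - 1 / (3 - a)) = 1 / (2 - a) := by
    rw [one_sub_div h3a, div_div_div_cancel_right₀ h3a]
    ring
  have hsq : 1 - a ^ 2 * (1 / (3 - a)) ^ 2 = 3 * (3 - 2 * a) / (3 - a) ^ 2 := by
    field_simp
    ring
  rw [bohrTailBound, hlin, hsq]
  set b := 3 - 2 * a with hb
  field_simp
  rw [hb]
  ring

theorem sq_add_bohrTailBound_le_one {a : ℝ} (ha : 0 ≤ a) (ha1 : a < 1) :
    a ^ 2 + bohrTailBound (9 / 8) a (1 / (3 - a)) ≤ 1 := by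
  have h1a : 0 ≤ 1 - a := by linarith
  have h2a : 0 < 2 - a := by linarith
  have h32a : 0 < 3 - 2 * a := by linarith
  have hcubic : 0 ≤ 54 - 39 * a + 6 * a ^ 2 - a ^ 3 := by
    nlinarith [pow_le_one₀ (n := 3) ha ha1.le]
  have hfactor : 9 * (3 - 2 * a) ^ 2 - 9 / 8 * ((1 + a) * (3 - a) ^ 2 * (2 - a)) =
      9 / 8 * ((1 - a) * (54 - 39 * a + 6 * a ^ 2 - a ^ 3)) := by ring
  rw [← sub_nonneg, one_sub_sq_add_bohrTailBound _ ha1, hfactor]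
  positivity

namespace IsAnalyticSelfMap

variable {f : ℂ → ℂ} {c r : ℝ}

theorem hasDiskSeries (hf : IsAnalyticSelfMap f) : HasDiskSeries (taylorSeries f) f :=
  hasDiskSeries_taylorSeries hf.analytic.differentiableOn

theorem norm_lt_one (hf : IsAnalyticSelfMap f) {z : ℂ} (hz : ‖z‖ < 1) : ‖f z‖ < 1 :=
  mem_ball_zero_iff.1 (hf.mapsTo (mem_ball_zero_iff.2 hz))

theorem norm_taylorCoeff_zero_lt_one (hf : IsAnalyticSelfMap f) : ‖taylorCoeff f 0‖ < 1 := by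
  rw [← coeff_taylorSeries, ← hf.hasDiskSeries.apply_zero]
  exact hf.norm_lt_one (by simp)

theorem summable_norm_taylorCoeff_mul_pow (hf : IsAnalyticSelfMap f) (hr : 0 ≤ r) (hr1 : r < 1) :
    Summable fun n => ‖taylorCoeff f n‖ * r ^ n := by
  simpa only [coeff_taylorSeries] using hf.hasDiskSeries.summable_norm hr hr1

theorem summable_sq_norm_taylorCoeff_succ_mul_pow (hf : IsAnalyticSelfMap f) (hr : 0 ≤ r)
    (hr1 : r < 1) : Summable fun n => ‖taylorCoeff f (n + 1)‖ ^ 2 * r ^ (2 * (n + 1)) := by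
  simpa only [coeff_taylorSeries] using
    (summable_nat_add_iff 1).2 (hf.hasDiskSeries.hasSum_sq_norm_coeff hr hr1).summable

theorem imageArea_lt_top (hf : IsAnalyticSelfMap f) (hr : 0 ≤ r) (hr1 : r < 1) :
    imageArea f r < ⊤ :=
  imageArea_eq_ofReal_pi_mul_tsum hf.analytic hr hr1 ▸ ENNReal.ofReal_lt_top

theorem imageArea_toReal_div_pi (hf : IsAnalyticSelfMap f) (hr : 0 ≤ r) (hr1 : r < 1) :
    (imageArea f r).toReal / Real.pi =
      ∑' n : ℕ, (n + 1) * ‖taylorCoeff f (n + 1)‖ ^ 2 * (r ^ 2) ^ (n + 1) := by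
  rw [imageArea_eq_ofReal_pi_mul_tsum hf.analytic hr hr1, ENNReal.toReal_ofReal (by positivity),
    mul_div_cancel_left₀ _ Real.pi_ne_zero]

theorem imageArea_toReal_div_pi_le (hf : IsAnalyticSelfMap f) (hr : 0 ≤ r)
    (hr2 : r ^ 2 ≤ 1 / 2) : (imageArea f r).toReal / Real.pi ≤
      (1 - ‖taylorCoeff f 0‖ ^ 2) ^ 2 * r ^ 2 / (1 - ‖taylorCoeff f 0‖ ^ 2 * r ^ 2) ^ 2 := by
  rw [hf.imageArea_toReal_div_pi hr (by nlinarith)]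
  refine Real.tsum_le_of_sum_range_le (fun n => by positivity) fun n => ?_
  simpa only [coeff_taylorSeries] using hf.hasDiskSeries.sum_succ_mul_sq_norm_coeff_le
    (fun z hz => (hf.norm_lt_one hz).le) (sq_nonneg r) hr2 n

theorem bohrSumD_eq (hf : IsAnalyticSelfMap f) (c : ℝ) (hr : 0 ≤ r) (hr1 : r < 1) :
    bohrSumD c f r = ‖taylorCoeff f 0‖ +
      (∑' n : ℕ, ‖taylorCoeff f (n + 1)‖ * r ^ (n + 1) + refinementTerm c f r) := by
  rw [bohrSumD, (hf.summable_norm_taylorCoeff_mul_pow hr hr1).tsum_eq_zero_add, pow_zero, mul_one,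
    add_assoc]

theorem tsum_add_refinementTerm_le (hf : IsAnalyticSelfMap f) (hc : 0 ≤ c) (hr : 0 ≤ r)
    (hr2 : r ^ 2 ≤ 1 / 2) :
    ∑' n : ℕ, ‖taylorCoeff f (n + 1)‖ * r ^ (n + 1) + refinementTerm c f r ≤
      bohrTailBound c ‖taylorCoeff f 0‖ r := by
  have hcoeff := hf.hasDiskSeries.tsum_norm_coeff_succ_add_le
    (fun z hz => (hf.norm_lt_one hz).le) hr (by nlinarith)
  simp only [coeff_taylorSeries] at hcoeff
  have harea := mul_le_mul_of_nonneg_left (hf.imageArea_toReal_div_pi_le hr hr2) hc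
  rw [refinementTerm, bohrTailBound, ← add_assoc]
  exact add_le_add hcoeff harea

theorem bohrSumD_le_one (hf : IsAnalyticSelfMap f) (hr : 0 ≤ r) (hr3 : r ≤ 1 / 3) :
    bohrSumD (8 / 9) f r ≤ 1 := by
  have ha := norm_nonneg (taylorCoeff f 0)
  have ha1 := hf.norm_taylorCoeff_zero_lt_one
  calc bohrSumD (8 / 9) f r
      ≤ ‖taylorCoeff f 0‖ + bohrTailBound (8 / 9) ‖taylorCoeff f 0‖ r := by
        rw [hf.bohrSumD_eq _ hr (by linarith)]
        gcongr
        exact hf.tsum_add_refinementTerm_le (by norm_num) hr (by nlinarith)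
    _ ≤ ‖taylorCoeff f 0‖ + bohrTailBound (8 / 9) ‖taylorCoeff f 0‖ (1 / 3) := by
        gcongr
        exact bohrTailBound_le_bohrTailBound (by norm_num) ha ha1 hr hr3 (by norm_num)
    _ ≤ 1 := add_bohrTailBound_one_third_le_one ha ha1

theorem bohrSumE_le_one (hf : IsAnalyticSelfMap f) (hr : 0 ≤ r)
    (hrR : r ≤ 1 / (3 - ‖taylorCoeff f 0‖)) : bohrSumE (9 / 8) f r ≤ 1 := by
  have ha := norm_nonneg (taylorCoeff f 0)
  have ha1 := hf.norm_taylorCoeff_zero_lt_one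
  have hR : 1 / (3 - ‖taylorCoeff f 0‖) ≤ 1 / 2 :=
    one_div_le_one_div_of_le two_pos (by linarith)
  calc bohrSumE (9 / 8) f r
      ≤ ‖taylorCoeff f 0‖ ^ 2 + bohrTailBound (9 / 8) ‖taylorCoeff f 0‖ r := by
        rw [bohrSumE, add_assoc]
        gcongr
        exact hf.tsum_add_refinementTerm_le (by norm_num) hr (by nlinarith)
    _ ≤ ‖taylorCoeff f 0‖ ^ 2 +
          bohrTailBound (9 / 8) ‖taylorCoeff f 0‖ (1 / (3 - ‖taylorCoeff f 0‖)) := by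
        gcongr
        exact bohrTailBound_le_bohrTailBound (by norm_num) ha ha1 hr hrR (by linarith)
    _ ≤ 1 := sq_add_bohrTailBound_le_one ha ha1

end IsAnalyticSelfMap

/-- The automorphism of the unit disk exchanging `0` and `a`, for `0 ≤ a < 1`. The family of these
maps as `a → 1` is extremal for both Bohr inequalities. -/
noncomputable def moebius (a : ℝ) (z : ℂ) : ℂ := (a - z) / (1 - a * z)

section Moebius

variable {a r : ℝ} {z : ℂ}

theorem sq_norm_one_sub_mul_sub_sq_norm_sub (a : ℝ) (z : ℂ) :
    ‖1 - a * z‖ ^ 2 - ‖a - z‖ ^ 2 = (1 - a ^ 2) * (1 - ‖z‖ ^ 2) := by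
  simp only [← Complex.normSq_eq_norm_sq, Complex.normSq_apply, Complex.sub_re, Complex.sub_im,
    Complex.mul_re, Complex.mul_im, Complex.ofReal_re, Complex.ofReal_im, Complex.one_re,
    Complex.one_im]
  ring

theorem norm_sub_lt_norm_one_sub_mul (ha : 0 ≤ a) (ha1 : a < 1) (hz : ‖z‖ < 1) :
    ‖a - z‖ < ‖1 - a * z‖ := by
  have hpos : 0 < (1 - a ^ 2) * (1 - ‖z‖ ^ 2) :=
    mul_pos (by nlinarith) (by nlinarith [norm_nonneg z])
  refine lt_of_pow_lt_pow_left₀ 2 (norm_nonneg _) ?_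
  linarith [sq_norm_one_sub_mul_sub_sq_norm_sub a z]

theorem one_sub_ofReal_mul_ne_zero (ha : 0 ≤ a) (ha1 : a < 1) (hz : ‖z‖ < 1) : 1 - a * z ≠ 0 :=
  norm_pos_iff.1 ((norm_nonneg _).trans_lt (norm_sub_lt_norm_one_sub_mul ha ha1 hz))

theorem isAnalyticSelfMap_moebius (ha : 0 ≤ a) (ha1 : a < 1) : IsAnalyticSelfMap (moebius a) where
  analytic := by
    have hdiff : DifferentiableOn ℂ (moebius a) (Metric.ball 0 1) :=
      DifferentiableOn.fun_div (by fun_prop) (by fun_prop) fun z hz =>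
        one_sub_ofReal_mul_ne_zero ha ha1 (mem_ball_zero_iff.1 hz)
    exact hdiff.analyticOnNhd Metric.isOpen_ball
  mapsTo z hz := by
    have hlt := norm_sub_lt_norm_one_sub_mul ha ha1 (mem_ball_zero_iff.1 hz)
    rw [mem_ball_zero_iff, moebius, norm_div]
    exact (div_lt_one ((norm_nonneg _).trans_lt hlt)).2 hlt

theorem hasDiskSeries_moebius (ha : 0 ≤ a) (ha1 : a < 1) :
    HasDiskSeries (PowerSeries.C (a : ℂ) -
      PowerSeries.X * PowerSeries.mk fun n => (1 - a ^ 2 : ℂ) * a ^ n) (moebius a) := by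
  intro z hz
  have hne := one_sub_ofReal_mul_ne_zero ha ha1 hz
  have hlt : ‖(a : ℂ) * z‖ < 1 := by
    rw [norm_mul, Complex.norm_real, Real.norm_of_nonneg ha]
    nlinarith [norm_nonneg z]
  have hgeom := (hasSum_geometric_of_norm_lt_one hlt).mul_left (-((1 - a ^ 2) * z) : ℂ)
  have hzero : moebius a z - a = -((1 - a ^ 2) * z) * (1 - a * z)⁻¹ := by
    rw [moebius]
    field_simp
    ring
  refine (hasSum_nat_add_iff' 1).1 ?_
  simp only [Finset.sum_range_one, map_sub, PowerSeries.coeff_zero_C, PowerSeries.coeff_zero_X_mul,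
    PowerSeries.coeff_succ_C, PowerSeries.coeff_succ_X_mul, PowerSeries.coeff_mk, pow_zero,
    sub_zero, mul_one, zero_sub]
  rw [hzero]
  refine hgeom.congr_fun fun n => ?_
  rw [mul_pow]
  ring

theorem taylorSeries_moebius (ha : 0 ≤ a) (ha1 : a < 1) :
    taylorSeries (moebius a) = PowerSeries.C (a : ℂ) -
      PowerSeries.X * PowerSeries.mk fun n => (1 - a ^ 2 : ℂ) * a ^ n :=
  (isAnalyticSelfMap_moebius ha ha1).hasDiskSeries.unique (hasDiskSeries_moebius ha ha1)

theorem norm_taylorCoeff_moebius_zero (ha : 0 ≤ a) (ha1 : a < 1) :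
    ‖taylorCoeff (moebius a) 0‖ = a := by
  rw [← coeff_taylorSeries, taylorSeries_moebius ha ha1, map_sub, PowerSeries.coeff_zero_C,
    PowerSeries.coeff_zero_X_mul, sub_zero, Complex.norm_real, Real.norm_of_nonneg ha]

theorem norm_taylorCoeff_moebius_succ (ha : 0 ≤ a) (ha1 : a < 1) (n : ℕ) :
    ‖taylorCoeff (moebius a) (n + 1)‖ = (1 - a ^ 2) * a ^ n := by
  have hnonneg : 0 ≤ (1 - a ^ 2) * a ^ n := mul_nonneg (by nlinarith) (by positivity)
  rw [← coeff_taylorSeries, taylorSeries_moebius ha ha1, map_sub, PowerSeries.coeff_succ_C,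
    PowerSeries.coeff_succ_X_mul, PowerSeries.coeff_mk, zero_sub, norm_neg]
  exact_mod_cast (Complex.norm_real _).trans (Real.norm_of_nonneg hnonneg)

theorem tsum_norm_taylorCoeff_moebius_succ (ha : 0 ≤ a) (ha1 : a < 1) (hr : 0 ≤ r) (hr1 : r < 1) :
    ∑' n : ℕ, ‖taylorCoeff (moebius a) (n + 1)‖ * r ^ (n + 1) =
      (1 - a ^ 2) * r / (1 - a * r) := by
  simp_rw [norm_taylorCoeff_moebius_succ ha ha1]
  rw [div_eq_mul_inv, ← tsum_geometric_of_lt_one (by positivity) (by nlinarith : a * r < 1),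
    ← tsum_mul_left]
  exact tsum_congr fun n => by ring

theorem tsum_sq_norm_taylorCoeff_moebius_succ (ha : 0 ≤ a) (ha1 : a < 1) (hr : 0 ≤ r)
    (hr1 : r < 1) :
    ∑' n : ℕ, ‖taylorCoeff (moebius a) (n + 1)‖ ^ 2 * r ^ (2 * (n + 1)) =
      (1 - a ^ 2) ^ 2 * r ^ 2 / (1 - (a * r) ^ 2) := by
  have har : (a * r) ^ 2 < 1 := pow_lt_one₀ (by positivity) (by nlinarith) two_ne_zero
  simp_rw [norm_taylorCoeff_moebius_succ ha ha1]
  rw [div_eq_mul_inv, ← tsum_geometric_of_lt_one (by positivity) har, ← tsum_mul_left]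
  exact tsum_congr fun n => by ring

theorem imageArea_moebius_toReal_div_pi (ha : 0 ≤ a) (ha1 : a < 1) (hr : 0 ≤ r) (hr1 : r < 1) :
    (imageArea (moebius a) r).toReal / Real.pi =
      (1 - a ^ 2) ^ 2 * r ^ 2 / (1 - a ^ 2 * r ^ 2) ^ 2 := by
  have har : (a * r) ^ 2 < 1 := pow_lt_one₀ (by positivity) (by nlinarith) two_ne_zero
  have harabs : |(a * r) ^ 2| < 1 := by rwa [abs_of_nonneg (by positivity)]
  rw [(isAnalyticSelfMap_moebius ha ha1).imageArea_toReal_div_pi hr hr1]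
  simp_rw [norm_taylorCoeff_moebius_succ ha ha1]
  rw [← mul_pow a r, div_eq_mul_one_div, ← (hasSum_succ_mul_geometric harabs).tsum_eq,
    ← tsum_mul_left]
  exact tsum_congr fun n => by ring

theorem tsum_add_refinementTerm_moebius (c : ℝ) (ha : 0 ≤ a) (ha1 : a < 1) (hr : 0 ≤ r)
    (hr1 : r < 1) :
    ∑' n : ℕ, ‖taylorCoeff (moebius a) (n + 1)‖ * r ^ (n + 1) + refinementTerm c (moebius a) r =
      bohrTailBound c a r := by
  have h1r : 1 - r ≠ 0 := by linarith
  have h1a : 1 + a ≠ 0 := by linarith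
  have h1ar : 1 - a * r ≠ 0 := by nlinarith
  have h1ar' : 1 + a * r ≠ 0 := by positivity
  rw [refinementTerm, tsum_norm_taylorCoeff_moebius_succ ha ha1 hr hr1,
    tsum_sq_norm_taylorCoeff_moebius_succ ha ha1 hr hr1,
    imageArea_moebius_toReal_div_pi ha ha1 hr hr1, norm_taylorCoeff_moebius_zero ha ha1,
    ← add_assoc, bohrTailBound, show 1 - (a * r) ^ 2 = (1 - a * r) * (1 + a * r) by ring]
  congr 1
  field_simp
  ring

theorem bohrSumD_moebius (c : ℝ) (ha : 0 ≤ a) (ha1 : a < 1) (hr : 0 ≤ r) (hr1 : r < 1) :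
    bohrSumD c (moebius a) r = a + bohrTailBound c a r := by
  rw [(isAnalyticSelfMap_moebius ha ha1).bohrSumD_eq c hr hr1,
    tsum_add_refinementTerm_moebius c ha ha1 hr hr1, norm_taylorCoeff_moebius_zero ha ha1]

theorem bohrSumE_moebius (c : ℝ) (ha : 0 ≤ a) (ha1 : a < 1) (hr : 0 ≤ r) (hr1 : r < 1) :
    bohrSumE c (moebius a) r = a ^ 2 + bohrTailBound c a r := by
  rw [bohrSumE, add_assoc, tsum_add_refinementTerm_moebius c ha ha1 hr hr1,
    norm_taylorCoeff_moebius_zero ha ha1]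

end Moebius

theorem exists_lt_one_pos_of_continuousAt {g : ℝ → ℝ} (hg : ContinuousAt g 1) (hg1 : 0 < g 1) :
    ∃ a : ℝ, 0 ≤ a ∧ a < 1 ∧ 0 < g a := by
  have hpos : ∀ᶠ a in 𝓝[<] (1 : ℝ), 0 < g a :=
    hg.continuousWithinAt.eventually (lt_mem_nhds hg1)
  obtain ⟨a, hga, ha, ha1⟩ := (hpos.and (Ico_mem_nhdsLT zero_lt_one)).exists
  exact ⟨a, ha, ha1, hga⟩

theorem exists_one_lt_bohrSumD {c r : ℝ} (hc : 0 ≤ c) (hr : 1 / 3 < r) (hr1 : r < 1) :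
    ∃ f : ℂ → ℂ, IsAnalyticSelfMap f ∧ 1 < bohrSumD c f r := by
  obtain ⟨a, ha, ha1, hpos⟩ := exists_lt_one_pos_of_continuousAt
    (g := fun a => (1 + a) * r - (1 - r)) (by fun_prop) (by linarith)
  have h1r : 0 < 1 - r := sub_pos.2 hr1
  have h1a : 0 < 1 - a := sub_pos.2 ha1
  have harea : 0 ≤ c * ((1 - a ^ 2) ^ 2 * r ^ 2 / (1 - a ^ 2 * r ^ 2) ^ 2) := by positivity
  refine ⟨moebius a, isAnalyticSelfMap_moebius ha ha1, ?_⟩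
  calc (1 : ℝ) < 1 + (1 - a) * ((1 + a) * r - (1 - r)) / (1 - r) :=
        lt_add_of_pos_right 1 (by positivity)
    _ = a + (1 - a ^ 2) * (r / (1 - r)) := by
        field_simp
        ring
    _ ≤ a + bohrTailBound c a r := by
        rw [bohrTailBound]
        linarith
    _ = bohrSumD c (moebius a) r := (bohrSumD_moebius c ha ha1 (by linarith) hr1).symm

theorem exists_one_lt_bohrSumD_one_third {c : ℝ} (hc : 8 / 9 < c) :
    ∃ f : ℂ → ℂ, IsAnalyticSelfMap f ∧ 1 < bohrSumD c f (1 / 3) := by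
  obtain ⟨a, ha, ha1, hpos⟩ := exists_lt_one_pos_of_continuousAt
    (g := fun a => 18 * c * (1 + a) ^ 2 - (9 - a ^ 2) ^ 2) (by fun_prop) (by linarith)
  have h1a : 0 < 1 - a := sub_pos.2 ha1
  have ha9 : 0 < 9 - a ^ 2 := by nlinarith
  refine ⟨moebius a, isAnalyticSelfMap_moebius ha ha1, ?_⟩
  rw [bohrSumD_moebius c ha ha1 (by norm_num) (by norm_num), ← sub_neg,
    one_sub_add_bohrTailBound_one_third c (by linarith)]
  exact div_neg_of_neg_of_pos (mul_neg_of_pos_of_neg (by positivity) (by linarith))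
    (by positivity)

theorem exists_one_lt_bohrSumE {c : ℝ} (hc : 9 / 8 < c) :
    ∃ f : ℂ → ℂ, IsAnalyticSelfMap f ∧ 1 < bohrSumE c f (1 / (3 - ‖taylorCoeff f 0‖)) := by
  obtain ⟨a, ha, ha1, hpos⟩ := exists_lt_one_pos_of_continuousAt
    (g := fun a => c * ((1 + a) * (3 - a) ^ 2 * (2 - a)) - 9 * (3 - 2 * a) ^ 2)
    (by fun_prop) (by linarith)
  have h1a : 0 < 1 - a := by linarith
  have h2a : 0 < 2 - a := by linarith
  have h3a : 0 < 3 - a := by linarith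
  have h32a : 0 < 3 - 2 * a := by linarith
  refine ⟨moebius a, isAnalyticSelfMap_moebius ha ha1, ?_⟩
  rw [norm_taylorCoeff_moebius_zero ha ha1, bohrSumE_moebius c ha ha1 (by positivity)
    ((div_lt_one h3a).2 (by linarith)), ← sub_neg, one_sub_sq_add_bohrTailBound c ha1]
  exact div_neg_of_neg_of_pos (mul_neg_of_pos_of_neg (by positivity) (by linarith))
    (by positivity)

theorem theorem4 :
    -- all the series converge and the area is finite for `0 ≤ r < 1`
    (∀ f : ℂ → ℂ, IsAnalyticSelfMap f → ∀ r : ℝ, 0 ≤ r → r < 1 →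
      Summable (fun n : ℕ => ‖taylorCoeff f n‖ * r ^ n) ∧
      Summable (fun n : ℕ => ‖taylorCoeff f (n + 1)‖ ^ 2 * r ^ (2 * (n + 1))) ∧
      imageArea f r < ⊤) ∧
    -- the first inequality
    (∀ f : ℂ → ℂ, IsAnalyticSelfMap f → ∀ r : ℝ, 0 ≤ r → r ≤ 1 / 3 →
      bohrSumD (8 / 9) f r ≤ 1) ∧
    -- the radius `1 / 3` cannot be improved
    (∀ r : ℝ, 1 / 3 < r → r < 1 →
      ∃ f : ℂ → ℂ, IsAnalyticSelfMap f ∧ 1 < bohrSumD (8 / 9) f r) ∧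
    -- the constant `8 / 9` cannot be improved
    (∀ c : ℝ, 8 / 9 < c →
      ∃ f : ℂ → ℂ, IsAnalyticSelfMap f ∧ 1 < bohrSumD c f (1 / 3)) ∧
    -- the second inequality
    (∀ f : ℂ → ℂ, IsAnalyticSelfMap f → ∀ r : ℝ, 0 ≤ r → r ≤ 1 / (3 - ‖taylorCoeff f 0‖) →
      bohrSumE (9 / 8) f r ≤ 1) ∧
    -- the constant `9 / 8` cannot be improved
    (∀ c : ℝ, 9 / 8 < c →
      ∃ f : ℂ → ℂ, IsAnalyticSelfMap f ∧
        1 < bohrSumE c f (1 / (3 - ‖taylorCoeff f 0‖))) := by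
  refine ⟨fun f hf r hr hr1 => ⟨?_, ?_, ?_⟩, fun f hf r => ?_, fun r => ?_, fun c => ?_,
    fun f hf r => ?_, fun c => ?_⟩
  · exact hf.summable_norm_taylorCoeff_mul_pow hr hr1
  · exact hf.summable_sq_norm_taylorCoeff_succ_mul_pow hr hr1
  · exact hf.imageArea_lt_top hr hr1
  · exact hf.bohrSumD_le_one
  · exact exists_one_lt_bohrSumD (by norm_num)
  · exact exists_one_lt_bohrSumD_one_third
  · exact hf.bohrSumE_le_one
  · exact exists_one_lt_bohrSumE
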